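/- **Theorem (Error-dominated oscillation).** There is an absolute constant $C$, independent of all quantities below, with the following property. Let $\Omega\subset\mathbb R^d$, $d\ge 1$, be a nonempty bounded open set. Let $H^1_0(\Omega)$ be the closure of $C_0^\infty(\Omega)$ in $H^1(\Omega)$, let $H^{-1}(\Omega)$ be its dual, with duality pairing $\langle\cdot,\cdot\rangle$ and norm $\|\Phi\|_{H^{-1}(\Omega)}=\sup_{v\in H^1_0(\Omega)\setminus\{0\}}\langle\Phi,v\rangle/\|\nabla v\|_\Omega$, and embed $L^2(\Omega)$ in $H^{-1}(\Omega)$ by $\langle w,v\rangle=(w,v)_\Omega$, where $(\cdot,\cdot)_\Omega$ and $\|\cdot\|_\Omega$ are the inner product and norm of $L^2$ on $\Omega$. Let $T>0$ and $Y=L^2(0,T;H^1_0(\Omega))\cap H^1(0,T;H^{-1}(\Omega))\subset C([0,T];L^2(\Omega))$. Let $f\in L^2(0,T;H^{-1}(\Omega))$ and $u_0\in H^1_0(\Omega)$, and let $u\in Y$ be the weak solution of the heat equation: $u(0)=u_0$ and $$\langle\partial_t u(t),v\rangle+(\nabla u(t),\nabla v)_\Omega=\langle f(t),v\rangle\qquad\forall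 v\in H^1_0(\Omega),\ \text{for a.e. }t\in(0,T).$$ Let $0=t_0<t_1<\dots<t_N=T$, $I_n=(t_{n-1},t_n)$, $\tau_n=t_n-t_{n-1}$. Let $f_n=\frac1{\tau_n}\int_{I_n}f(t)\,dt\in H^{-1}(\Omega)$ be the temporal mean values of $f$, and let $u_n\in H^1_0(\Omega)$, $1\le n\le N$, be the implicit Euler approximations $$\Big(\frac{u_n-u_{n-1}}{\tau_n},v\Big)_\Omega+(\nabla u_n,\nabla v)_\Omega=\langle f_n,v\rangle\qquad\forall v\in H^1_0(\Omega).$$ Let $f_\tau=f_n$ on $I_n$, let $u_\tau$ be the left-continuous piecewise constant function on $[0,T]$ with $u_\tau=u_n$ on $(t_{n-1},t_n]$ and $u_\tau(0)=u_0$, and let $U_\tau$ be the continuous function on $[0,T]$ that is affine on each $\overline{I_n}$ with $U_\tau(t_n)=u_n$ for $0\le n\le N$. Then $u-U_\tau\in Y$ and, for every $n\in\{1,\dots,N\}$, $$\int_{I_n}\Big(\|\nabla(u_\tau-U_\tau)\|_\Omega^2+\|f-f_\tau\|_{H^{-1}(\Omega)}^2\Big)dt\le C\int_{I_n}\Big(\|\partial_t(u-U_\tau)\|_{H^{-1}(\Omega)}^2+\|\nabla(u-U_\tau)\|_\Omega^2\Big)dt.$$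 -/

import Mathlib

open MeasureTheory Set
open scoped ENNReal NNReal ContDiff

namespace HeatEuler

/-- The Euclidean space `ℝᵈ`. -/
abbrev E (d : ℕ) : Type := EuclideanSpace ℝ (Fin d)

/-- `L²(Ω)`. -/
abbrev L2 {d : ℕ} (Ω : Set (E d)) : Type := Lp ℝ 2 (volume.restrict Ω)

/-- `L²(Ω; ℝᵈ)`. -/
abbrev L2vec {d : ℕ} (Ω : Set (E d)) : Type := Lp (E d) 2 (volume.restrict Ω)

/-- The Hilbert space `L²(Ω) × L²(Ω; ℝᵈ)` of pairs `(v, g)`, with norm `(‖v‖² + ‖g‖²)^(1/2)`.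
A function `v` of `H¹(Ω)` is represented by the pair `(v, ∇v)`, so that this norm is the
norm of `H¹(Ω)`. -/
abbrev PairSpace {d : ℕ} (Ω : Set (E d)) : Type := WithLp 2 (L2 Ω × L2vec Ω)

/-- `φ ∈ C₀^∞(D)`: `φ` is smooth with compact support contained in `D`. -/
def IsTestFunction {F : Type*} [NormedAddCommGroup F] [NormedSpace ℝ F]
    (D : Set F) (φ : F → ℝ) : Prop :=
  ContDiff ℝ ∞ φ ∧ HasCompactSupport φ ∧ tsupport φ ⊆ D

theorem IsTestFunction.add {F : Type*} [NormedAddCommGroup F] [NormedSpace ℝ F]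
    {D : Set F} {φ ψ : F → ℝ} (hφ : IsTestFunction D φ) (hψ : IsTestFunction D ψ) :
    IsTestFunction D (fun x => φ x + ψ x) :=
  ⟨hφ.1.add hψ.1, hφ.2.1.add hψ.2.1,
    (tsupport_add φ ψ).trans (union_subset hφ.2.2 hψ.2.2)⟩

theorem IsTestFunction.const_mul {F : Type*} [NormedAddCommGroup F] [NormedSpace ℝ F]
    {D : Set F} {φ : F → ℝ} (c : ℝ) (hφ : IsTestFunction D φ) :
    IsTestFunction D (fun x => c * φ x) :=
  ⟨contDiff_const.mul hφ.1, hφ.2.1.mul_left,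
    (tsupport_mul_subset_right (f := fun _ => c) (g := φ)).trans hφ.2.2⟩

/-- The subspace `{(φ, ∇φ) : φ ∈ C₀^∞(Ω)}`. -/
def testPairs {d : ℕ} (Ω : Set (E d)) : Submodule ℝ (PairSpace Ω) where
  carrier := {p | ∃ φ : E d → ℝ, IsTestFunction Ω φ ∧
    (p.fst =ᵐ[volume.restrict Ω] φ) ∧ (p.snd =ᵐ[volume.restrict Ω] gradient φ)}
  zero_mem' := by
    refine ⟨fun _ => 0, ⟨contDiff_const, HasCompactSupport.zero, ?_⟩, ?_, ?_⟩
    · simp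
    · exact Lp.coeFn_zero _ _ _
    · filter_upwards [Lp.coeFn_zero (E d) 2 (volume.restrict Ω)] with x hx
      simpa [gradient] using hx
  add_mem' := by
    rintro p q ⟨φ, hφ, hp1, hp2⟩ ⟨ψ, hψ, hq1, hq2⟩
    refine ⟨fun x => φ x + ψ x, hφ.add hψ, ?_, ?_⟩
    · filter_upwards [Lp.coeFn_add p.fst q.fst, hp1, hq1] with x h h1 h2
      change (p.fst + q.fst) x = _
      rw [h, Pi.add_apply, h1, h2]
    · filter_upwards [Lp.coeFn_add p.snd q.snd, hp2, hq2] with x h h1 h2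
      change (p.snd + q.snd) x = _
      rw [h, Pi.add_apply, h1, h2]
      have e := fderiv_fun_add (hφ.1.differentiable (by simp)).differentiableAt
        (hψ.1.differentiable (by simp)).differentiableAt (x := x)
      simp [gradient, e]
  smul_mem' := by
    rintro c p ⟨φ, hφ, hp1, hp2⟩
    refine ⟨fun x => c * φ x, hφ.const_mul c, ?_, ?_⟩
    · filter_upwards [Lp.coeFn_smul c p.fst, hp1] with x h h1
      change (c • p.fst) x = _
      rw [h, Pi.smul_apply, h1, smul_eq_mul]
    · filter_upwards [Lp.coeFn_smul c p.snd, hp2] with x h h1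
      change (c • p.snd) x = _
      rw [h, Pi.smul_apply, h1]
      have e := fderiv_const_mul (hφ.1.differentiable (by simp)).differentiableAt c (x := x)
      simp [gradient, e]

/-- `H¹₀(Ω)`: the closure of `C₀^∞(Ω)` with respect to the norm of `H¹(Ω)`. Its elements are the
pairs `(v, ∇v)`, and it carries the norm of `H¹(Ω)`. (Weak gradients are unique and the set of
pairs `(v, ∇v)` with `v ∈ H¹(Ω)` is closed in `L²(Ω) × L²(Ω; ℝᵈ)`, so the closure may be taken in
the product space.) -/
noncomputable def H10 {d : ℕ} (Ω : Set (E d)) : Submodule ℝ (PairSpace Ω) := (testPairs Ω).topologicalClosure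

/-- The embedding `H¹₀(Ω) → L²(Ω)`. -/
noncomputable def toL2 {d : ℕ} (Ω : Set (E d)) : H10 Ω →L[ℝ] L2 Ω :=
  (WithLp.fstL 2 ℝ (L2 Ω) (L2vec Ω)).comp (H10 Ω).subtypeL

/-- The weak gradient `v ↦ ∇v`, from `H¹₀(Ω)` to `L²(Ω; ℝᵈ)`. -/
noncomputable def grad {d : ℕ} (Ω : Set (E d)) : H10 Ω →L[ℝ] L2vec Ω :=
  (WithLp.sndL 2 ℝ (L2 Ω) (L2vec Ω)).comp (H10 Ω).subtypeL

/-- `H⁻¹(Ω)`, the space of bounded linear functionals on `H¹₀(Ω)`. For bounded `Ω` the norm of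
this type (dual to the full norm of `H¹(Ω)`) is equivalent to `dualNorm`; it is only used for the
topology of `H⁻¹(Ω)`, i.e. for measurability, for Bochner integrals and for membership in `L²`. -/
abbrev Hm1 {d : ℕ} (Ω : Set (E d)) : Type := StrongDual ℝ (H10 Ω)

/-- The norm of `H⁻¹(Ω)`, with values in `[0, ∞]`: the supremum of `⟨Φ, v⟩ / ‖∇v‖` over all nonzero
`v` in `H¹₀(Ω)`. -/
noncomputable def dualNorm {d : ℕ} {Ω : Set (E d)} (Φ : Hm1 Ω) : ℝ≥0∞ :=
  ⨆ (v : H10 Ω) (_ : v ≠ 0), ENNReal.ofReal (Φ v / ‖grad Ω v‖)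

/-- The canonical embedding `H¹₀(Ω) ⊂ L²(Ω) ⊂ H⁻¹(Ω)`: `⟨w, v⟩ = ∫_Ω w v`. -/
noncomputable def toHm1 {d : ℕ} {Ω : Set (E d)} (w : H10 Ω) : Hm1 Ω :=
  (innerSL ℝ (toL2 Ω w)).comp (toL2 Ω)

/-- `w ∈ L¹(a,b;V)` is a weak derivative on `(a,b)` of `v ∈ L¹(a,b;V)`. -/
def HasWeakTimeDeriv {V : Type*} [NormedAddCommGroup V] [NormedSpace ℝ V]
    (a b : ℝ) (v w : ℝ → V) : Prop :=
  IntegrableOn v (Ioo a b) ∧ IntegrableOn w (Ioo a b) ∧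
    ∀ φ : ℝ → ℝ, IsTestFunction (Ioo a b) φ →
      ∫ s in Ioo a b, deriv φ s • v s = - ∫ s in Ioo a b, φ s • w s

open Classical in
/-- The weak time derivative `∂ₜ v` on `(a,b)` (unique up to a null set if it exists; zero
if there is none). -/
noncomputable def timeDeriv {V : Type*} [NormedAddCommGroup V] [NormedSpace ℝ V]
    (a b : ℝ) (v : ℝ → V) : ℝ → V :=
  if h : ∃ w, HasWeakTimeDeriv a b v w then h.choose else 0

/-- `φ ∈ Y = L²(0,T;H¹₀(Ω)) ∩ H¹(0,T;H⁻¹(Ω))`. -/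
def MemY {d : ℕ} {Ω : Set (E d)} (T : ℝ) (φ : ℝ → H10 Ω) : Prop :=
  MemLp φ 2 (volume.restrict (Ioo 0 T)) ∧
    ∃ w : ℝ → Hm1 Ω, MemLp w 2 (volume.restrict (Ioo 0 T)) ∧
      HasWeakTimeDeriv 0 T (fun s => toHm1 (φ s)) w

/-- `φ(0) = v₀` in the sense of the embedding of `Y` into `C([0,T];L²(Ω))`: the representative of
`φ` that is continuous from `[0,T]` to `L²(Ω)` takes the value `v₀` at time zero. -/
def HasInitialValue {d : ℕ} {Ω : Set (E d)} (T : ℝ) (φ : ℝ → H10 Ω) (v₀ : L2 Ω) : Prop :=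
  ∃ ψ : ℝ → L2 Ω, ContinuousOn ψ (Icc 0 T) ∧
    (∀ᵐ s ∂(volume.restrict (Ioo 0 T)), ψ s = toL2 Ω (φ s)) ∧ ψ 0 = v₀

/-- `u ∈ Y` is the weak solution of `∂ₜu - Δu = f` in `Ω × (0,T)`, `u = 0` on `∂Ω × (0,T)`,
`u(0) = u₀`. -/
structure IsWeakSolution {d : ℕ} {Ω : Set (E d)} (T : ℝ) (f : ℝ → Hm1 Ω) (u₀ : L2 Ω)
    (u : ℝ → H10 Ω) : Prop where
  memY : MemY T u
  equation : ∀ v : H10 Ω, ∀ᵐ s ∂(volume.restrict (Ioo 0 T)),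
    timeDeriv 0 T (fun r => toHm1 (u r)) s v + inner ℝ (grad Ω (u s)) (grad Ω v) = f s v
  initial : HasInitialValue T u u₀

/-- The temporal mean values of `f` over the intervals `(t n, t (n+1))`. -/
noncomputable def meanValue {d : ℕ} {Ω : Set (E d)} {N : ℕ} (t : Fin (N + 1) → ℝ)
    (f : ℝ → Hm1 Ω) (n : Fin N) : Hm1 Ω :=
  (t n.succ - t n.castSucc)⁻¹ • ∫ s in Ioo (t n.castSucc) (t n.succ), f s

/-- `U 0, …, U N` are the implicit Euler approximations for the initial value `u₀ ∈ H¹₀(Ω)` and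
the right-hand sides `F n ∈ H⁻¹(Ω)` (on the time interval from `t n` to `t (n+1)`). -/
def IsImplicitEuler {d : ℕ} {Ω : Set (E d)} {N : ℕ} (t : Fin (N + 1) → ℝ) (F : Fin N → Hm1 Ω)
    (u₀ : H10 Ω) (U : Fin (N + 1) → H10 Ω) : Prop :=
  U 0 = u₀ ∧ ∀ (n : Fin N) (v : H10 Ω),
    inner ℝ (toL2 Ω ((t n.succ - t n.castSucc)⁻¹ • (U n.succ - U n.castSucc))) (toL2 Ω v) +
      inner ℝ (grad Ω (U n.succ)) (grad Ω v) = F n v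

/-- The left-continuous piecewise constant reconstruction `u_τ`: it equals `U (n+1)` on
`(t n, t (n+1)]`, and `U 0` at time `t 0`. -/
noncomputable def pwConst {V : Type*} [AddCommMonoid V] {N : ℕ} (t : Fin (N + 1) → ℝ)
    (U : Fin (N + 1) → V) (s : ℝ) : V :=
  ({t 0} : Set ℝ).indicator (fun _ => U 0) s +
    ∑ n : Fin N, (Ioc (t n.castSucc) (t n.succ)).indicator (fun _ => U n.succ) s

/-- The continuous piecewise affine reconstruction `U_τ`, with value `U n` at time `t n`. -/
noncomputable def pwAffine {V : Type*} [AddCommGroup V] [Module ℝ V] {N : ℕ}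
    (t : Fin (N + 1) → ℝ) (U : Fin (N + 1) → V) (s : ℝ) : V :=
  ({t 0} : Set ℝ).indicator (fun _ => U 0) s +
    ∑ n : Fin N, (Ioc (t n.castSucc) (t n.succ)).indicator
      (fun r => ((r - t n.castSucc) / (t n.succ - t n.castSucc)) • U n.succ +
        ((t n.succ - r) / (t n.succ - t n.castSucc)) • U n.castSucc) s

/-- The piecewise constant function `f_τ` that equals `F n` on `(t n, t (n+1))`. -/
noncomputable def pwData {V : Type*} [AddCommMonoid V] {N : ℕ} (t : Fin (N + 1) → ℝ)
    (F : Fin N → V) (s : ℝ) : V :=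
  ∑ n : Fin N, (Ioo (t n.castSucc) (t n.succ)).indicator (fun _ => F n) s

end HeatEuler

/-! Write `A` for the weak Laplacian `w ↦ (∇w, ∇·)`. On `I_n` put `D = u_n - u_{n-1}`, `g = f - f_n`
and `θ(s) = (t_n - s)/τ_n`, so that `u_τ - U_τ = θ D`. Subtracting the Euler equation from the heat
equation gives the residual identity `∂ₜ(u - U_τ) + A(u - U_τ) = g + θ A D =: R`. Hence `‖R‖` in
`H⁻¹` is at most the sum of the two error norms, and it remains to bound `θ D` and `g` by `R`.

The two parts of `R` cannot cancel, since `g` has mean zero on `I_n` and `θ` has mean `1/2`. Testing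
`R` with the fixed element `D` and integrating removes `g` and leaves `τ_n ‖∇D‖² / 2`; Young's
inequality absorbs half of this and gives `τ_n ‖∇D‖² ≤ 4 ∫ ‖R‖²` (`mul_sq_le_lintegral`). Then `g =
R - θ A D` is bounded by the triangle inequality (`lintegral_oscillation_le`). `oscillation_le`
combines these with the residual identity. -/

namespace HeatEuler

/-! ### Piecewise constant and piecewise affine interpolants in time. -/

section Piecewise

variable {V : Type*} [NormedAddCommGroup V] {N : ℕ} {t : Fin (N + 1) → ℝ}

theorem eq_of_mem_Ioc_of_mem_Ioc (ht : StrictMono t) {m n : Fin N} {s : ℝ}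
    (hm : s ∈ Ioc (t m.castSucc) (t m.succ)) (hn : s ∈ Ioc (t n.castSucc) (t n.succ)) : m = n := by
  have h1 := ht.lt_iff_lt.1 (hm.1.trans_le hn.2)
  have h2 := ht.lt_iff_lt.1 (hn.1.trans_le hm.2)
  simp only [Fin.lt_def, Fin.val_castSucc, Fin.val_succ] at h1 h2
  ext
  omega

theorem ne_of_mem_Ioc (ht : StrictMono t) {n : Fin N} {s : ℝ}
    (hs : s ∈ Ioc (t n.castSucc) (t n.succ)) : s ≠ t 0 :=
  ((ht.monotone (Fin.zero_le _)).trans_lt hs.1).ne'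

theorem pwConst_of_mem (ht : StrictMono t) (U : Fin (N + 1) → V) {n : Fin N} {s : ℝ}
    (hs : s ∈ Ioc (t n.castSucc) (t n.succ)) : pwConst t U s = U n.succ := by
  rw [pwConst, indicator_of_notMem (by simpa using ne_of_mem_Ioc ht hs), zero_add,
    Finset.sum_eq_single n _ (by simp), indicator_of_mem hs]
  intro m _ hm
  exact indicator_of_notMem (fun h => hm (eq_of_mem_Ioc_of_mem_Ioc ht h hs)) _

theorem pwData_of_mem (ht : StrictMono t) (F : Fin N → V) {n : Fin N} {s : ℝ}
    (hs : s ∈ Ioo (t n.castSucc) (t n.succ)) : pwData t F s = F n := by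
  rw [pwData, Finset.sum_eq_single n _ (by simp), indicator_of_mem hs]
  intro m _ hm
  exact indicator_of_notMem (fun h => hm
    (eq_of_mem_Ioc_of_mem_Ioc ht (Ioo_subset_Ioc_self h) (Ioo_subset_Ioc_self hs))) _

theorem memLp_pwData (F : Fin N → V) {p : ℝ≥0∞} (μ : Measure ℝ) [IsFiniteMeasure μ] :
    MemLp (pwData t F) p μ := by
  have h : pwData t F = fun s => ∑ n : Fin N,
      (Ioo (t n.castSucc) (t n.succ)).indicator (fun _ => F n) s := rfl
  rw [h]
  exact memLp_finsetSum _ fun n _ => (memLp_const _).indicator measurableSet_Ioo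

variable [NormedSpace ℝ V]

theorem pwAffine_of_mem (ht : StrictMono t) (U : Fin (N + 1) → V) {n : Fin N} {s : ℝ}
    (hs : s ∈ Ioc (t n.castSucc) (t n.succ)) :
    pwAffine t U s = ((s - t n.castSucc) / (t n.succ - t n.castSucc)) • U n.succ +
        ((t n.succ - s) / (t n.succ - t n.castSucc)) • U n.castSucc := by
  rw [pwAffine, indicator_of_notMem (by simpa using ne_of_mem_Ioc ht hs), zero_add,
    Finset.sum_eq_single n _ (by simp), indicator_of_mem hs]
  intro m _ hm
  exact indicator_of_notMem (fun h => hm (eq_of_mem_Ioc_of_mem_Ioc ht h hs)) _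

theorem map_pwAffine {W : Type*} [NormedAddCommGroup W] [NormedSpace ℝ W] (A : V →L[ℝ] W)
    (U : Fin (N + 1) → V) (s : ℝ) :
    A (pwAffine t U s) = pwAffine t (fun n => A (U n)) s := by
  simp only [pwAffine, map_add, map_sum]
  congr 1
  · by_cases h : s ∈ ({t 0} : Set ℝ) <;> simp [h]
  · refine Finset.sum_congr rfl fun n _ => ?_
    by_cases h : s ∈ Ioc (t n.castSucc) (t n.succ)
    · simp [indicator_of_mem h]
    · simp [indicator_of_notMem h]

theorem memLp_pwAffine (U : Fin (N + 1) → V) {p : ℝ≥0∞} (μ : Measure ℝ) [IsFiniteMeasure μ] :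
    MemLp (pwAffine t U) p μ := by
  refine MemLp.add ((memLp_const _).indicator (measurableSet_singleton _))
    (memLp_finsetSum _ fun n _ => ?_)
  -- On its interval each affine piece is a convex combination of the two nodal values.
  refine MemLp.of_bound (C := ‖U n.succ‖ + ‖U n.castSucc‖)
    ((Continuous.aestronglyMeasurable (by fun_prop)).indicator measurableSet_Ioc)
    (Filter.Eventually.of_forall fun s => ?_)
  by_cases hs : s ∈ Ioc (t n.castSucc) (t n.succ)
  · rw [indicator_of_mem hs]
    have h0 : 0 < t n.succ - t n.castSucc := by linarith [hs.1, hs.2]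
    refine (norm_add_le _ _).trans (add_le_add ?_ ?_) <;>
    · rw [norm_smul, Real.norm_eq_abs]
      refine mul_le_of_le_one_left (norm_nonneg _) ?_
      rw [abs_of_nonneg (div_nonneg (by linarith [hs.1, hs.2]) h0.le), div_le_one h0]
      linarith [hs.1, hs.2]
  · rw [indicator_of_notMem hs, norm_zero]
    positivity

/-- Integration by parts on one interval. The boundary terms are kept because they telescope over
the partition. -/
theorem integral_deriv_smul_affine [CompleteSpace V] {φ : ℝ → ℝ} (hφ : ContDiff ℝ ∞ φ)
    {a b : ℝ} (hab : a < b) (x y : V) :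
    ∫ s in a..b, deriv φ s • (((s - a) / (b - a)) • y + ((b - s) / (b - a)) • x) =
      (φ b • y - φ a • x) - ∫ s in a..b, φ s • ((b - a)⁻¹ • (y - x)) := by
  have hd : ∀ s, HasDerivAt φ (deriv φ s) s := fun s =>
    (hφ.differentiable (by simp)).differentiableAt.hasDerivAt
  have hc : Continuous (deriv φ) := hφ.continuous_deriv (by simp)
  have hℓ : ∀ s : ℝ, HasDerivAt (fun s => ((s - a) / (b - a)) • y + ((b - s) / (b - a)) • x)
      ((b - a)⁻¹ • (y - x)) s := by
    intro s
    have h1 : HasDerivAt (fun s : ℝ => (s - a) / (b - a)) (1 / (b - a)) s :=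
      ((hasDerivAt_id s).sub_const a).div_const _
    have h2 : HasDerivAt (fun s : ℝ => (b - s) / (b - a)) (-1 / (b - a)) s :=
      ((hasDerivAt_id s).const_sub b).div_const _
    refine ((h1.smul_const y).add (h2.smul_const x)).congr_deriv ?_
    rw [smul_sub, neg_div, neg_smul, one_div, ← sub_eq_add_neg]
  have h := intervalIntegral.integral_smul_deriv_eq_deriv_smul_of_hasDerivAt (a := a) (b := b)
    hφ.continuous.continuousOn (fun s _ => (hℓ s).continuousAt.continuousWithinAt)
    (fun s _ => hd s) (fun s _ => hℓ s) (hc.intervalIntegrable _ _)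
    (continuous_const.intervalIntegrable _ _)
  rw [h]
  have h0 : b - a ≠ 0 := (sub_pos.2 hab).ne'
  simp [div_self h0]

/-- The piecewise affine interpolant is weakly differentiable, and its derivative is the piecewise
constant function of difference quotients. -/
theorem hasWeakTimeDeriv_pwAffine [CompleteSpace V] (ht : StrictMono t) (U : Fin (N + 1) → V) :
    HasWeakTimeDeriv (t 0) (t (Fin.last N)) (pwAffine t U)
      (pwData t fun n => (t n.succ - t n.castSucc)⁻¹ • (U n.succ - U n.castSucc)) := by
  refine ⟨memLp_one_iff_integrable.1 (memLp_pwAffine U _),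
    memLp_one_iff_integrable.1 (memLp_pwData _ _), fun φ hφ => ?_⟩
  have hle : ∀ n : Fin N, t n.castSucc < t n.succ := fun n => ht n.castSucc_lt_succ
  have hsub : ∀ n : Fin N, Ioc (t n.castSucc) (t n.succ) ⊆ Ioc (t 0) (t (Fin.last N)) := fun n =>
    Ioc_subset_Ioc (ht.monotone (Fin.zero_le _)) (ht.monotone (Fin.le_last _))
  have hsub' : ∀ n : Fin N, Ioo (t n.castSucc) (t n.succ) ⊆ Ioo (t 0) (t (Fin.last N)) := fun n =>
    Ioo_subset_Ioo (ht.monotone (Fin.zero_le _)) (ht.monotone (Fin.le_last _))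
  have hc : Continuous (deriv φ) := hφ.1.continuous_deriv (by simp)
  have hcφ : Continuous φ := hφ.1.continuous
  have h1 : ∫ s in Ioo (t 0) (t (Fin.last N)), deriv φ s • pwAffine t U s =
      ∑ n : Fin N, ∫ s in (t n.castSucc)..(t n.succ), deriv φ s •
        (((s - t n.castSucc) / (t n.succ - t n.castSucc)) • U n.succ +
          ((t n.succ - s) / (t n.succ - t n.castSucc)) • U n.castSucc) := by
    rw [← integral_Ioc_eq_integral_Ioo]
    have : ∀ s ∈ Ioc (t 0) (t (Fin.last N)), deriv φ s • pwAffine t U s =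
        ∑ n : Fin N, (Ioc (t n.castSucc) (t n.succ)).indicator (fun s => deriv φ s •
        (((s - t n.castSucc) / (t n.succ - t n.castSucc)) • U n.succ +
          ((t n.succ - s) / (t n.succ - t n.castSucc)) • U n.castSucc)) s := by
      intro s hs
      rw [pwAffine, indicator_of_notMem (by simpa using hs.1.ne'), zero_add, Finset.smul_sum]
      refine Finset.sum_congr rfl fun n _ => ?_
      by_cases h : s ∈ Ioc (t n.castSucc) (t n.succ)
      · simp only [indicator_of_mem h]
      · simp only [indicator_of_notMem h, smul_zero]
    rw [setIntegral_congr_fun measurableSet_Ioc this, integral_finsetSum]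
    · refine Finset.sum_congr rfl fun n _ => ?_
      rw [integral_indicator measurableSet_Ioc, Measure.restrict_restrict measurableSet_Ioc,
        inter_eq_self_of_subset_left (hsub n), intervalIntegral.integral_of_le (hle n).le]
    · intro n _
      exact (Continuous.integrableOn_Ioc (by fun_prop)).integrable.indicator measurableSet_Ioc
  have h2 : ∫ s in Ioo (t 0) (t (Fin.last N)), φ s •
        pwData t (fun n => (t n.succ - t n.castSucc)⁻¹ • (U n.succ - U n.castSucc)) s =
      ∑ n : Fin N, ∫ s in (t n.castSucc)..(t n.succ), φ s •
        ((t n.succ - t n.castSucc)⁻¹ • (U n.succ - U n.castSucc)) := by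
    have : ∀ s, φ s •
        pwData t (fun n => (t n.succ - t n.castSucc)⁻¹ • (U n.succ - U n.castSucc)) s =
        ∑ n : Fin N, (Ioo (t n.castSucc) (t n.succ)).indicator (fun s => φ s •
        ((t n.succ - t n.castSucc)⁻¹ • (U n.succ - U n.castSucc))) s := by
      intro s
      rw [pwData, Finset.smul_sum]
      refine Finset.sum_congr rfl fun n _ => ?_
      by_cases h : s ∈ Ioo (t n.castSucc) (t n.succ)
      · simp only [indicator_of_mem h]
      · simp only [indicator_of_notMem h, smul_zero]
    simp only [this]
    rw [integral_finsetSum]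
    · refine Finset.sum_congr rfl fun n _ => ?_
      rw [integral_indicator measurableSet_Ioo, Measure.restrict_restrict measurableSet_Ioo,
        inter_eq_self_of_subset_left (hsub' n), intervalIntegral.integral_of_le (hle n).le,
        integral_Ioc_eq_integral_Ioo]
    · intro n _
      exact ((Continuous.integrableOn_Ioc (by fun_prop)).mono_set
        Ioo_subset_Ioc_self).integrable.indicator measurableSet_Ioo
  -- The support lies in the open interval, so both endpoint values vanish.
  have e0 : φ (t 0) = 0 := image_eq_zero_of_notMem_tsupport fun h => lt_irrefl _ (hφ.2.2 h).1
  have eN : φ (t (Fin.last N)) = 0 :=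
    image_eq_zero_of_notMem_tsupport fun h => lt_irrefl _ (hφ.2.2 h).2
  -- The interpolant is continuous, so the boundary terms at interior nodes cancel. The sum over all
  -- nodes is expanded twice, splitting off the first or the last term, both zero.
  have tel : ∑ n : Fin N, (φ (t n.succ) • U n.succ - φ (t n.castSucc) • U n.castSucc) = 0 := by
    have a1 := Fin.sum_univ_succ fun i => φ (t i) • U i
    have a2 := Fin.sum_univ_castSucc fun i => φ (t i) • U i
    simp only [e0, eN, zero_smul, zero_add, add_zero] at a1 a2
    rw [Finset.sum_sub_distrib, ← a1, ← a2, sub_self]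
  rw [h1, h2, Finset.sum_congr rfl fun n _ => integral_deriv_smul_affine hφ.1 (hle n) _ _,
    Finset.sum_sub_distrib, tel, zero_sub]

end Piecewise

/-! ### Weak time derivatives: linearity and uniqueness. -/

section WeakTimeDeriv

variable {V : Type*} [NormedAddCommGroup V] [NormedSpace ℝ V] {a b : ℝ} {v w v' w' : ℝ → V}

theorem IsTestFunction.integrableOn_smul {φ : ℝ → ℝ} (hφ : IsTestFunction (Ioo a b) φ)
    (hv : IntegrableOn v (Ioo a b)) : IntegrableOn (fun s => φ s • v s) (Ioo a b) := by
  obtain ⟨C, hC⟩ := hφ.2.1.exists_bound_of_continuous hφ.1.continuous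
  exact Integrable.bdd_smul hv C hφ.1.continuous.aestronglyMeasurable
    (Filter.Eventually.of_forall hC)

theorem IsTestFunction.integrableOn_deriv_smul {φ : ℝ → ℝ} (hφ : IsTestFunction (Ioo a b) φ)
    (hv : IntegrableOn v (Ioo a b)) : IntegrableOn (fun s => deriv φ s • v s) (Ioo a b) := by
  have hc : Continuous (deriv φ) := hφ.1.continuous_deriv (by simp)
  obtain ⟨C, hC⟩ := hφ.2.1.deriv.exists_bound_of_continuous hc
  exact Integrable.bdd_smul hv C hc.aestronglyMeasurable (Filter.Eventually.of_forall hC)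

theorem HasWeakTimeDeriv.sub (h : HasWeakTimeDeriv a b v w) (h' : HasWeakTimeDeriv a b v' w') :
    HasWeakTimeDeriv a b (fun s => v s - v' s) (fun s => w s - w' s) := by
  refine ⟨h.1.sub h'.1, h.2.1.sub h'.2.1, fun φ hφ => ?_⟩
  simp only [smul_sub]
  rw [integral_sub (hφ.integrableOn_deriv_smul h.1) (hφ.integrableOn_deriv_smul h'.1),
    integral_sub (hφ.integrableOn_smul h.2.1) (hφ.integrableOn_smul h'.2.1),
    h.2.2 φ hφ, h'.2.2 φ hφ]
  abel

/-- The fundamental lemma of the calculus of variations, applied to `w - w'`. -/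
theorem HasWeakTimeDeriv.ae_unique [CompleteSpace V] (h : HasWeakTimeDeriv a b v w)
    (h' : HasWeakTimeDeriv a b v w') : w =ᵐ[volume.restrict (Ioo a b)] w' := by
  have key := isOpen_Ioo.ae_eq_zero_of_integral_contDiff_smul_eq_zero (μ := volume)
    (U := Ioo a b) (f := fun s => w s - w' s) (h.2.1.sub h'.2.1).locallyIntegrableOn ?_
  · refine (ae_restrict_iff' measurableSet_Ioo).2 (key.mono fun s hs hm => ?_)
    exact sub_eq_zero.1 (hs hm)
  · intro φ h1 h2 h3
    have hφ : IsTestFunction (Ioo a b) φ := ⟨h1, h2, h3⟩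
    rw [← setIntegral_eq_integral_of_forall_compl_eq_zero (s := Ioo a b)]
    · simp only [smul_sub]
      rw [integral_sub (hφ.integrableOn_smul h.2.1) (hφ.integrableOn_smul h'.2.1), sub_eq_zero,
        ← neg_inj, ← h.2.2 φ hφ, h'.2.2 φ hφ]
    · intro s hs
      rw [image_eq_zero_of_notMem_tsupport fun hm => hs (h3 hm), zero_smul]

/-- `timeDeriv` is an arbitrary choice; by uniqueness any explicit weak derivative may replace it
almost everywhere. -/
theorem HasWeakTimeDeriv.timeDeriv_ae_eq [CompleteSpace V] (h : HasWeakTimeDeriv a b v w) :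
    timeDeriv a b v =ᵐ[volume.restrict (Ioo a b)] w := by
  have hex : ∃ w, HasWeakTimeDeriv a b v w := ⟨w, h⟩
  rw [timeDeriv, dif_pos hex]
  exact hex.choose_spec.ae_unique h

end WeakTimeDeriv

end HeatEuler

/-! ### The dual norm and the residual estimate on one interval. -/

namespace HeatEuler

variable {H K : Type*} [NormedAddCommGroup H] [NormedSpace ℝ H]
  [NormedAddCommGroup K] [InnerProductSpace ℝ K] (G : H →L[ℝ] K)

/-- The operator `w ↦ (v ↦ (G w, G v))` from `H` to its dual. -/
noncomputable def gramOperator : H →L[ℝ] StrongDual ℝ H :=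
  ((ContinuousLinearMap.compL ℝ H K ℝ).flip G).comp ((innerSL ℝ).comp G)

theorem gramOperator_apply (w v : H) : gramOperator G w v = inner ℝ (G w) (G v) := rfl

/-- The norm on the dual of `H` that is dual to the seminorm `v ↦ ‖G v‖`. -/
noncomputable def dualNormOf (Φ : StrongDual ℝ H) : ℝ≥0∞ :=
  ⨆ (v : H) (_ : v ≠ 0), ENNReal.ofReal (Φ v / ‖G v‖)

theorem ofReal_div_le_dualNormOf (Φ : StrongDual ℝ H) (v : H) :
    ENNReal.ofReal (Φ v / ‖G v‖) ≤ dualNormOf G Φ := by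
  by_cases hv : v = 0
  · simp [hv]
  · exact le_iSup₂_of_le v hv le_rfl

theorem dualNormOf_add_le (Φ Ψ : StrongDual ℝ H) :
    dualNormOf G (Φ + Ψ) ≤ dualNormOf G Φ + dualNormOf G Ψ := by
  refine iSup₂_le fun v _ => ?_
  rw [add_apply, add_div]
  exact ENNReal.ofReal_add_le.trans
    (add_le_add (ofReal_div_le_dualNormOf G Φ v) (ofReal_div_le_dualNormOf G Ψ v))

theorem dualNormOf_gramOperator_le (w : H) : dualNormOf G (gramOperator G w) ≤ ‖G w‖ₑ := by
  refine iSup₂_le fun v _ => ?_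
  rw [← ofReal_norm, gramOperator_apply]
  exact ENNReal.ofReal_le_ofReal (div_le_of_le_mul₀ (norm_nonneg _) (norm_nonneg _)
    (real_inner_le_norm _ _))

theorem ennreal_add_sq_le (a b : ℝ≥0∞) : (a + b) ^ 2 ≤ 2 * (a ^ 2 + b ^ 2) := by
  have h := ENNReal.rpow_add_le_mul_rpow_add_rpow a b (p := 2) one_le_two
  norm_num at h
  exact h

/-- Young's inequality for the duality pairing. -/
theorem ofReal_apply_le (Φ : StrongDual ℝ H) {v : H} (hv : G v ≠ 0) :
    ENNReal.ofReal (Φ v) ≤ dualNormOf G Φ ^ 2 + ENNReal.ofReal (‖G v‖ ^ 2 / 4) := by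
  have hγ : 0 < ‖G v‖ := norm_pos_iff.2 hv
  set γ := ‖G v‖
  set q := Φ v / γ
  have h1 : Φ v = q * γ := (div_mul_cancel₀ _ hγ.ne').symm
  rcases le_or_gt (Φ v) 0 with h | h
  · simp [ENNReal.ofReal_of_nonpos h]
  have hq : 0 ≤ q := (div_pos h hγ).le
  calc ENNReal.ofReal (Φ v) ≤ ENNReal.ofReal (q ^ 2 + γ ^ 2 / 4) :=
        -- This is `(q - γ/2)² ≥ 0`. The weight `1/4` is half of the mean `1/2` of `θ`, so the term
        -- can be absorbed later.
        ENNReal.ofReal_le_ofReal (by rw [h1]; nlinarith [sq_nonneg (q - γ / 2)])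
    _ = ENNReal.ofReal q ^ 2 + ENNReal.ofReal (γ ^ 2 / 4) := by
        rw [ENNReal.ofReal_add (by positivity) (by positivity), ENNReal.ofReal_pow hq]
    _ ≤ _ := by gcongr; exact ofReal_div_le_dualNormOf G Φ v

/-- Functionals depending on a parameter that agree almost everywhere when tested with each fixed
element of `H` agree almost everywhere. -/
theorem ae_eq_of_forall_apply [TopologicalSpace.SeparableSpace H] {α : Type*}
    [MeasurableSpace α] {μ : Measure α} {g h : α → StrongDual ℝ H}
    (hgh : ∀ v, ∀ᵐ s ∂μ, g s v = h s v) : g =ᵐ[μ] h := by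
  -- A countable dense set of test elements gives one common null set; continuity does the rest.
  have hd := TopologicalSpace.denseRange_denseSeq (H)
  filter_upwards [ae_all_iff.2 fun k => hgh (TopologicalSpace.denseSeq (H) k)] with s hs
  exact DFunLike.coe_injective
    (hd.equalizer (g s).continuous (h s).continuous (funext hs))

theorem integral_affine_weight {a b : ℝ} (hab : a < b) :
    ∫ s in Ioo a b, (b - s) / (b - a) = (b - a) / 2 := by
  rw [← integral_Ioc_eq_integral_Ioo, ← intervalIntegral.integral_of_le hab.le,
    intervalIntegral.integral_div, intervalIntegral.integral_sub (by simp) (by simp)]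
  have h0 : b - a ≠ 0 := (sub_pos.2 hab).ne'
  simp only [intervalIntegral.integral_const, integral_id, smul_eq_mul]
  field_simp
  ring

/-- If `g` has mean value zero on `(a,b)`, the increment `w` is controlled by the residual
`g + θ A w`, where `θ` is the affine function with `θ a = 1` and `θ b = 0`. -/
theorem mul_sq_le_lintegral {a b : ℝ} (hab : a < b) {g : ℝ → StrongDual ℝ H}
    (hg : IntegrableOn g (Ioo a b)) (hg0 : ∫ s in Ioo a b, g s = 0) (w : H) :
    ENNReal.ofReal (b - a) * ‖G w‖ₑ ^ 2 ≤
      4 * ∫⁻ s in Ioo a b, dualNormOf G (g s + ((b - s) / (b - a)) • gramOperator G w) ^ 2 := by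
  by_cases hw : G w = 0
  · simp [hw]
  set γ := ‖G w‖ with hγ
  set θ : ℝ → ℝ := fun s => (b - s) / (b - a) with hθ
  set R : ℝ → StrongDual ℝ H := fun s => g s + θ s • gramOperator G w with hR
  have hba : 0 < b - a := sub_pos.2 hab
  have hθi : IntegrableOn θ (Ioo a b) :=
    (Continuous.integrableOn_Ioc (by fun_prop)).mono_set Ioo_subset_Ioc_self
  have hgi : IntegrableOn (fun s => g s w) (Ioo a b) := hg.apply_continuousLinearMap w
  have hg0' : ∫ s in Ioo a b, g s w = 0 := by
    rw [← ContinuousLinearMap.integral_apply hg, hg0, zero_apply]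
  have hRw : ∀ s, R s w = g s w + θ s * γ ^ 2 := fun s => by
    simp [hR, gramOperator_apply, hγ]
  -- The mean-zero part drops out because the test element `w` does not depend on `s`.
  have hint : ∫ s in Ioo a b, R s w = (b - a) * γ ^ 2 / 2 := by
    simp only [hRw]
    rw [integral_add hgi (hθi.mul_const _), hg0', integral_mul_const, integral_affine_weight hab]
    ring
  have hRi : IntegrableOn (fun s => R s w) (Ioo a b) := by
    simp only [hRw]
    exact hgi.add (hθi.mul_const _)
  have hle : ENNReal.ofReal ((b - a) * γ ^ 2 / 2) ≤
      (∫⁻ s in Ioo a b, dualNormOf G (R s) ^ 2) + ENNReal.ofReal ((b - a) * γ ^ 2 / 4) := by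
    calc ENNReal.ofReal ((b - a) * γ ^ 2 / 2)
        ≤ ∫⁻ s in Ioo a b, ENNReal.ofReal (R s w) := by
          -- Only the positive part is kept, as the dual norm bounds `R s w` from above.
          rw [← hint, integral_eq_lintegral_pos_part_sub_lintegral_neg_part hRi]
          exact (ENNReal.ofReal_le_ofReal (sub_le_self _ ENNReal.toReal_nonneg)).trans
            ENNReal.ofReal_toReal_le
      _ ≤ ∫⁻ s in Ioo a b, (dualNormOf G (R s) ^ 2 + ENNReal.ofReal (γ ^ 2 / 4)) :=
          lintegral_mono fun s => ofReal_apply_le G _ hw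
      _ = _ := by
          -- The constant is the measurable summand, so measurability of the dual norm of `R` is not
          -- needed.
          rw [lintegral_add_right _ measurable_const, setLIntegral_const, Real.volume_Ioo,
            ← ENNReal.ofReal_mul (by positivity)]
          congr 2
          ring
  have hsplit : ENNReal.ofReal ((b - a) * γ ^ 2 / 2) =
      ENNReal.ofReal ((b - a) * γ ^ 2 / 4) + ENNReal.ofReal ((b - a) * γ ^ 2 / 4) := by
    rw [← ENNReal.ofReal_add (by positivity) (by positivity)]
    congr 1
    ring
  rw [hsplit, ENNReal.add_le_add_iff_right ENNReal.ofReal_ne_top] at hle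
  calc ENNReal.ofReal (b - a) * ‖G w‖ₑ ^ 2
      = 4 * ENNReal.ofReal ((b - a) * γ ^ 2 / 4) := by
        rw [← ofReal_norm, ← ENNReal.ofReal_pow (norm_nonneg _), ← ENNReal.ofReal_mul hba.le,
          show (4 : ℝ≥0∞) = ENNReal.ofReal 4 by simp, ← ENNReal.ofReal_mul (by norm_num)]
        congr 1
        ring
    _ ≤ _ := by gcongr

/-- The oscillation `g` and the jump term are controlled by the residual. -/
theorem lintegral_oscillation_le {a b : ℝ} (hab : a < b) {g : ℝ → StrongDual ℝ H}
    (hg : IntegrableOn g (Ioo a b)) (hg0 : ∫ s in Ioo a b, g s = 0) (w : H) :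
    ∫⁻ s in Ioo a b, (‖G (((b - s) / (b - a)) • w)‖ₑ ^ 2 + dualNormOf G (g s) ^ 2) ≤
      14 * ∫⁻ s in Ioo a b, dualNormOf G (g s + ((b - s) / (b - a)) • gramOperator G w) ^ 2 := by
  set R : ℝ → StrongDual ℝ H := fun s => g s + ((b - s) / (b - a)) • gramOperator G w with hR
  have hba : 0 < b - a := sub_pos.2 hab
  calc ∫⁻ s in Ioo a b, (‖G (((b - s) / (b - a)) • w)‖ₑ ^ 2 + dualNormOf G (g s) ^ 2)
      ≤ ∫⁻ s in Ioo a b, (3 * ‖G w‖ₑ ^ 2 + 2 * dualNormOf G (R s) ^ 2) := by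
        refine setLIntegral_mono' measurableSet_Ioo fun s hs => ?_
        have h1 : ‖G (((b - s) / (b - a)) • w)‖ₑ ≤ ‖G w‖ₑ := by
          rw [← ofReal_norm, ← ofReal_norm, map_smul, norm_smul]
          refine ENNReal.ofReal_le_ofReal (mul_le_of_le_one_left (norm_nonneg _) ?_)
          rw [Real.norm_eq_abs, abs_of_nonneg (div_nonneg (by linarith [hs.2]) hba.le),
            div_le_one hba]
          linarith [hs.1]
        -- The minus sign goes inside the operator, so that subadditivity and the bound for
        -- `gramOperator` apply directly.
        have h2 : g s = R s + gramOperator G (-(((b - s) / (b - a)) • w)) := by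
          simp [hR]
        have h3 : dualNormOf G (g s) ≤ dualNormOf G (R s) + ‖G w‖ₑ := by
          rw [h2]
          refine (dualNormOf_add_le G _ _).trans (add_le_add le_rfl ?_)
          refine (dualNormOf_gramOperator_le G _).trans ?_
          rwa [map_neg, enorm_neg]
        calc _ ≤ ‖G w‖ₑ ^ 2 + (dualNormOf G (R s) + ‖G w‖ₑ) ^ 2 := by gcongr
          _ ≤ ‖G w‖ₑ ^ 2 + 2 * (dualNormOf G (R s) ^ 2 + ‖G w‖ₑ ^ 2) := by
            gcongr
            exact ennreal_add_sq_le _ _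
          _ = _ := by ring
    _ = 3 * (ENNReal.ofReal (b - a) * ‖G w‖ₑ ^ 2) +
          2 * ∫⁻ s in Ioo a b, dualNormOf G (R s) ^ 2 := by
        rw [lintegral_add_left measurable_const, setLIntegral_const, Real.volume_Ioo,
          lintegral_const_mul' _ _ (by simp)]
        ring
    -- The final constant of this estimate is `3 · 4 + 2 = 14`.
    _ ≤ 3 * (4 * ∫⁻ s in Ioo a b, dualNormOf G (R s) ^ 2) +
          2 * ∫⁻ s in Ioo a b, dualNormOf G (R s) ^ 2 := by
        exact add_le_add (mul_le_mul_right (mul_sq_le_lintegral G hab hg hg0 w) 3) le_rfl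
    _ = _ := by ring

theorem sq_dualNormOf_add_gramOperator_le (Φ : StrongDual ℝ H) (w : H) :
    dualNormOf G (Φ + gramOperator G w) ^ 2 ≤ 2 * (dualNormOf G Φ ^ 2 + ‖G w‖ₑ ^ 2) := by
  refine le_trans ?_ (ennreal_add_sq_le _ _)
  gcongr
  exact (dualNormOf_add_le G _ _).trans (add_le_add le_rfl (dualNormOf_gramOperator_le G w))

end HeatEuler

namespace HeatEuler

/-! ### The error equation in an abstract setting: `G` plays the gradient, `J` the embedding into
`L²`. -/

section Abstract

variable {H K L : Type*} [NormedAddCommGroup H] [NormedSpace ℝ H]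
  [NormedAddCommGroup K] [InnerProductSpace ℝ K] [NormedAddCommGroup L] [InnerProductSpace ℝ L]
  (G : H →L[ℝ] K) (J : H →L[ℝ] L) {N : ℕ} {t : Fin (N + 1) → ℝ} {T : ℝ}

theorem hasWeakTimeDeriv_sub_pwAffine (ht : StrictMono t) (ht0 : t 0 = 0)
    (htN : t (Fin.last N) = T) {u : ℝ → H} {w : ℝ → StrongDual ℝ H}
    (hw : HasWeakTimeDeriv 0 T (fun s => gramOperator J (u s)) w) (U : Fin (N + 1) → H) :
    HasWeakTimeDeriv 0 T (fun s => gramOperator J (u s - pwAffine t U s))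
      (fun s => w s - pwData t (fun n => (t n.succ - t n.castSucc)⁻¹ •
        (gramOperator J (U n.succ) - gramOperator J (U n.castSucc))) s) := by
  have h := hasWeakTimeDeriv_pwAffine ht fun n => gramOperator J (U n)
  rw [ht0, htN] at h
  simp only [map_sub, map_pwAffine]
  exact hw.sub h

theorem setIntegral_sub_mean_eq_zero {V : Type*} [NormedAddCommGroup V] [NormedSpace ℝ V]
    [CompleteSpace V] {a b : ℝ} (hab : a < b) {f : ℝ → V} (hf : IntegrableOn f (Ioo a b)) :
    ∫ s in Ioo a b, (f s - (b - a)⁻¹ • ∫ r in Ioo a b, f r) = 0 := by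
  rw [integral_sub hf (integrable_const _), setIntegral_const, Measure.real, Real.volume_Ioo,
    ENNReal.toReal_ofReal (sub_pos.2 hab).le, smul_smul, mul_inv_cancel₀ (sub_pos.2 hab).ne',
    one_smul, sub_self]

theorem exists_memLp_hasWeakTimeDeriv_sub_pwAffine (ht : StrictMono t) (ht0 : t 0 = 0)
    (htN : t (Fin.last N) = T) {u : ℝ → H} (hu : ∃ w : ℝ → StrongDual ℝ H,
      MemLp w 2 (volume.restrict (Ioo 0 T)) ∧
        HasWeakTimeDeriv 0 T (fun s => gramOperator J (u s)) w) (U : Fin (N + 1) → H) :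
    ∃ w : ℝ → StrongDual ℝ H, MemLp w 2 (volume.restrict (Ioo 0 T)) ∧
      HasWeakTimeDeriv 0 T (fun s => gramOperator J (u s - pwAffine t U s)) w :=
  let ⟨_, hwL, hw⟩ := hu
  ⟨_, hwL.sub (memLp_pwData _ _), hasWeakTimeDeriv_sub_pwAffine J ht ht0 htN hw U⟩

/-- The oscillation bound in an abstract Gelfand triple. -/
theorem oscillation_le [TopologicalSpace.SeparableSpace H] {f w : ℝ → StrongDual ℝ H}
    (hf : MemLp f 2 (volume.restrict (Ioo 0 T))) {u : ℝ → H}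
    (hw : HasWeakTimeDeriv 0 T (fun s => gramOperator J (u s)) w)
    (heq : ∀ v : H, ∀ᵐ s ∂(volume.restrict (Ioo 0 T)),
      timeDeriv 0 T (fun r => gramOperator J (u r)) s v + inner ℝ (G (u s)) (G v) = f s v)
    (ht : StrictMono t) (ht0 : t 0 = 0) (htN : t (Fin.last N) = T) {F : Fin N → StrongDual ℝ H}
    (hF : ∀ n : Fin N, F n =
      (t n.succ - t n.castSucc)⁻¹ • ∫ s in Ioo (t n.castSucc) (t n.succ), f s)
    {U : Fin (N + 1) → H}
    (hU : ∀ (n : Fin N) (v : H),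
      inner ℝ (J ((t n.succ - t n.castSucc)⁻¹ • (U n.succ - U n.castSucc))) (J v) +
        inner ℝ (G (U n.succ)) (G v) = F n v) (n : Fin N) :
    ∫⁻ s in Ioo (t n.castSucc) (t n.succ),
      (‖G (pwConst t U s - pwAffine t U s)‖ₑ ^ 2 + dualNormOf G (f s - pwData t F s) ^ 2) ≤
    28 * ∫⁻ s in Ioo (t n.castSucc) (t n.succ),
      (dualNormOf G (timeDeriv 0 T (fun r => gramOperator J (u r - pwAffine t U r)) s) ^ 2 +
        ‖G (u s - pwAffine t U s)‖ₑ ^ 2) := by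
  have hab : t n.castSucc < t n.succ := ht n.castSucc_lt_succ
  have hba : t n.succ - t n.castSucc ≠ 0 := (sub_pos.2 hab).ne'
  have hsub : Ioo (t n.castSucc) (t n.succ) ⊆ Ioo 0 T := by
    rw [← ht0, ← htN]
    exact Ioo_subset_Ioo (ht.monotone (Fin.zero_le _)) (ht.monotone (Fin.le_last _))
  have hfn : IntegrableOn f (Ioo (t n.castSucc) (t n.succ)) :=
    IntegrableOn.mono_set (hf.integrable one_le_two) hsub
  set D : H := U n.succ - U n.castSucc with hD
  set θ : ℝ → ℝ := fun s => (t n.succ - s) / (t n.succ - t n.castSucc) with hθ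
  have hjump : ∀ s ∈ Ioo (t n.castSucc) (t n.succ), U n.succ - pwAffine t U s = θ s • D := by
    intro s hs
    rw [pwAffine_of_mem ht U (Ioo_subset_Ioc_self hs), hD, hθ]
    have : (s - t n.castSucc) / (t n.succ - t n.castSucc) =
        1 - (t n.succ - s) / (t n.succ - t n.castSucc) := by
      field_simp
      ring
    rw [this]
    module
  -- The exceptional null set in `heq` depends on `v`; separability of `H` turns the equation into
  -- an identity of functionals.
  have hequ : timeDeriv 0 T (fun r => gramOperator J (u r)) =ᵐ[volume.restrict (Ioo 0 T)]
      fun s => f s - gramOperator G (u s) := by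
    refine ae_eq_of_forall_apply fun v => (heq v).mono fun s hs => ?_
    rw [sub_apply, ← hs, gramOperator_apply, add_sub_cancel_right]
  have hEuler : gramOperator J ((t n.succ - t n.castSucc)⁻¹ • D) =
      F n - gramOperator G (U n.succ) := by
    ext v
    rw [sub_apply, ← hU n v, gramOperator_apply, gramOperator_apply, add_sub_cancel_right]
  -- The residual identity: heat equation minus Euler equation, with `U n.succ - pwAffine t U s = θ
  -- s • D` producing the second term on the left.
  have herr : ∀ᵐ s ∂(volume.restrict (Ioo (t n.castSucc) (t n.succ))),
      f s - F n + θ s • gramOperator G D =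
        timeDeriv 0 T (fun r => gramOperator J (u r - pwAffine t U r)) s +
          gramOperator G (u s - pwAffine t U s) := by
    have h1 := ae_restrict_of_ae_restrict_of_subset hsub
      (hasWeakTimeDeriv_sub_pwAffine J ht ht0 htN hw U).timeDeriv_ae_eq
    have h2 := ae_restrict_of_ae_restrict_of_subset hsub hw.timeDeriv_ae_eq
    have h3 := ae_restrict_of_ae_restrict_of_subset hsub hequ
    filter_upwards [h1, h2, h3, ae_restrict_mem measurableSet_Ioo] with s h1 h2 h3 hs
    rw [h1, ← h2, h3, pwData_of_mem ht _ hs, ← map_sub, ← map_smul, ← map_smul, ← hD, hEuler,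
      ← hjump s hs, map_sub, map_sub]
    abel
  calc _ = ∫⁻ s in Ioo (t n.castSucc) (t n.succ),
        (‖G (θ s • D)‖ₑ ^ 2 + dualNormOf G (f s - F n) ^ 2) := by
        refine setLIntegral_congr_fun measurableSet_Ioo fun s hs => ?_
        simp only [pwConst_of_mem ht U (Ioo_subset_Ioc_self hs), hjump s hs,
          pwData_of_mem ht F hs]
    _ ≤ 14 * ∫⁻ s in Ioo (t n.castSucc) (t n.succ),
        dualNormOf G (f s - F n + θ s • gramOperator G D) ^ 2 :=
        lintegral_oscillation_le G hab (hfn.sub (integrable_const _))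
          (by rw [hF n]; exact setIntegral_sub_mean_eq_zero hab hfn) D
    _ ≤ 14 * ∫⁻ s in Ioo (t n.castSucc) (t n.succ),
        2 * (dualNormOf G (timeDeriv 0 T (fun r => gramOperator J (u r - pwAffine t U r)) s) ^ 2 +
          ‖G (u s - pwAffine t U s)‖ₑ ^ 2) := by
        gcongr 14 * ?_
        refine lintegral_mono_ae (herr.mono fun s hs => ?_)
        rw [hs]
        exact sq_dualNormOf_add_gramOperator_le G _ _
    _ = _ := by
        rw [lintegral_const_mul' _ _ (by simp), ← mul_assoc]
        norm_num

end Abstract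

/-- Supplies the countable dense set of test functions; separability passes from the `L²` spaces to
their product and to subspaces. -/
theorem separableSpace_H10 {d : ℕ} (Ω : Set (E d)) :
    TopologicalSpace.SeparableSpace (H10 Ω) :=
  have : Fact ((2 : ℝ≥0∞) ≠ ⊤) := ⟨ENNReal.ofNat_ne_top⟩
  have : SecondCountableTopology (L2 Ω) := Lp.SecondCountableTopology
  have : SecondCountableTopology (L2vec Ω) := Lp.SecondCountableTopology
  have : SecondCountableTopology (PairSpace Ω) :=
    WithLp.secondCountableTopology 2 (L2 Ω) (L2vec Ω)
  have : SecondCountableTopology (H10 Ω) := TopologicalSpace.Subtype.secondCountableTopology _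
  inferInstance

end HeatEuler

theorem mainTheorem4 :
    ∃ C : ℝ≥0, ∀ (d : ℕ) (_hd : 1 ≤ d) (Ω : Set (HeatEuler.E d))
      (_hΩo : IsOpen Ω) (_hΩb : Bornology.IsBounded Ω) (_hΩn : Ω.Nonempty)
      (T : ℝ) (_hT : 0 < T)
      (f : ℝ → HeatEuler.Hm1 Ω) (_hf : MemLp f 2 (volume.restrict (Ioo 0 T)))
      (u₀ : HeatEuler.H10 Ω) (u : ℝ → HeatEuler.H10 Ω)
      (_hu : HeatEuler.IsWeakSolution T f (HeatEuler.toL2 Ω u₀) u)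
      (N : ℕ) (t : Fin (N + 1) → ℝ) (_ht : StrictMono t)
      (_ht0 : t 0 = 0) (_htN : t (Fin.last N) = T)
      (U : Fin (N + 1) → HeatEuler.H10 Ω)
      (_hU : HeatEuler.IsImplicitEuler t (HeatEuler.meanValue t f) u₀ U),
      HeatEuler.MemY T (fun s => u s - HeatEuler.pwAffine t U s) ∧
      ∀ n : Fin N,
        ∫⁻ s in Ioo (t n.castSucc) (t n.succ),
          (‖HeatEuler.grad Ω (HeatEuler.pwConst t U s - HeatEuler.pwAffine t U s)‖ₑ ^ 2 +
            HeatEuler.dualNorm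
              (f s - HeatEuler.pwData t (HeatEuler.meanValue t f) s) ^ 2)
        ≤ C * ∫⁻ s in Ioo (t n.castSucc) (t n.succ),
          (HeatEuler.dualNorm (HeatEuler.timeDeriv 0 T
              (fun r => HeatEuler.toHm1 (u r - HeatEuler.pwAffine t U r)) s) ^ 2 +
            ‖HeatEuler.grad Ω (u s - HeatEuler.pwAffine t U s)‖ₑ ^ 2) := by
  -- `28 = 2 · 14`, the factor 2 coming from squaring the triangle inequality for the residual.
  refine ⟨28, ?_⟩
  intro d _ Ω _ _ _ T _ f hf u₀ u hu N t ht ht0 htN U hU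
  have := HeatEuler.separableSpace_H10 Ω
  refine ⟨⟨hu.memY.1.sub (HeatEuler.memLp_pwAffine U _),
    HeatEuler.exists_memLp_hasWeakTimeDeriv_sub_pwAffine (HeatEuler.toL2 Ω) ht ht0 htN
      hu.memY.2 U⟩, fun n => ?_⟩
  obtain ⟨w, -, hw⟩ := hu.memY.2
  -- `toHm1` and `dualNorm` unfold to `gramOperator (toL2 Ω)` and `dualNormOf (grad Ω)`, so the
  -- abstract bound applies as it stands.
  exact HeatEuler.oscillation_le (HeatEuler.grad Ω) (HeatEuler.toL2 Ω) hf hw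
    hu.equation ht ht0 htN (fun _ => rfl) hU.2 n
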